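/- Let $\mathsf{HI}:\mathbb F_2^6\to\mathbb F_2$ be Kushilevitz's hemi-icosahedron function: $\mathsf{HI}(x)=1$ if the Hamming weight of $x$ is $1$, $2$ or $6$; $\mathsf{HI}(x)=0$ if it is $0$, $4$ or $5$; and if it is $3$, then $\mathsf{HI}(x)=1$ if and only if the set $\{i : x_i=1\}$ is one of the ten facets $123$, $124$, $136$, $145$, $156$, $235$, $246$, $256$, $345$, $346$ of the hemi-icosahedron on the vertices $1,\dots,6$. Define its powers by $\mathsf{HI}^{\circ 1}:=\mathsf{HI}$ and $\mathsf{HI}^{\circ k}:=\mathsf{HI}\circ\mathsf{HI}^{\circ (k-1)}:\mathbb F_2^{6^k}\to\mathbb F_2$, where for $f:\mathbb F_2^n\to\mathbb F_2$ and $g:\mathbb F_2^m\to\mathbb F_2$ the composition $f\circ g:\mathbb F_2^{nm}\to\mathbb F_2$ is $(f\circ g)(y^{(1)},\dots,y^{(n)}):=f(g(y^{(1)}),\dots,g(y^{(n)}))$. For $f:\mathbb F_2^n\to\mathbb F_2$ let $\mathsf{sparsity}[\hat f]$ be the number of $\alpha\in\mathbb F_2^n$ such that the Fourier coefficient $\hat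 f(\alpha)=2^{-n}\sum_{x\in\mathbb F_2^n}(-1)^{f(x)+\langle x,\alpha\rangle}$ is nonzero, and let $\mathsf{DT}^{\oplus}[f]$ be the least depth of a parity decision tree computing $f$, that is, of a binary decision tree in which every internal node queries the parity $\sum_{i\in S}x_i\in\mathbb F_2$ of an arbitrary set $S\subseteq\{1,\dots,n\}$ of the variables. Then \[ \mathsf{DT}^{\oplus}[\mathsf{HI}^{\circ k}] = \Omega\Big(\big(\log \mathsf{sparsity}[\widehat{\mathsf{HI}^{\circ k}}]\big)^{\log_3 6}\Big): \] there is a constant $c>0$ such that for every integer $k\ge 1$ the function $f=\mathsf{HI}^{\circ k}$ on $n=6^k$ variables satisfies \[ \mathsf{DT}^{\oplus}[f]\ \ge\ c\,\big(\log_2 \mathsf{sparsity}[\hat f]\big)^{\log_3 6}. \] -/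

import Mathlib

/-! ### Boolean functions, composition and powers -/

/-- A Boolean function on variables indexed by `ι`, that is a map `F₂^ι → F₂`. -/
abbrev BoolFun (ι : Type*) : Type _ := (ι → ZMod 2) → ZMod 2

/-- Composition `f ∘ g : F₂^(n * m) → F₂` of `f : F₂^n → F₂` and `g : F₂^m → F₂`. The input is cut
into `n` consecutive blocks of length `m`; coordinate `j` of block `i` has index
`finProdFinEquiv (i, j) = j + m * i`. -/
def BoolFun.comp {n m : ℕ} (f : BoolFun (Fin n)) (g : BoolFun (Fin m)) : BoolFun (Fin (n * m)) :=
  fun y => f fun i => g fun j => y (finProdFinEquiv (i, j))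

/-- The `k`-th power of `f : F₂^n → F₂`, a function `F₂^(n ^ k) → F₂`: the zeroth power is the
identity function of one variable (so the first power is `f`), and the `(k+1)`-st power is
the composition of `f` with the `k`-th power. The cast identifies the index sets of size
`n * n ^ k` and `n ^ (k + 1)`. -/
def BoolFun.power {n : ℕ} (f : BoolFun (Fin n)) : (k : ℕ) → BoolFun (Fin (n ^ k))
  | 0 => fun x => x ⟨0, by simp⟩
  | k + 1 => fun x => f.comp (f.power k) fun i => x (Fin.cast (pow_succ' n k).symm i)

/-- The first power of `f` is `f`. -/
theorem BoolFun.power_one {n : ℕ} (f : BoolFun (Fin n)) (x : Fin (n ^ 1) → ZMod 2) :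
    f.power 1 x = f fun i => x (Fin.cast (pow_one n).symm i) := by
  simp only [BoolFun.power, BoolFun.comp]
  congr 1
  funext i
  congr 1
  ext
  change 0 + n ^ 0 * (i : ℕ) = i
  simp

/-! ### Fourier expansion and sparsity -/

/-- The identification of `0, 1 ∈ F₂` with `1, -1 ∈ ℝ`. -/
def bitSign (b : ZMod 2) : ℝ := if b = 0 then 1 else -1

/-- The Fourier coefficient of the `±1`-valued version of `f` at `α`:
the average over `x` of `(-1)^(f x) * (-1)^⟨x, α⟩`. -/
noncomputable def boolFourierCoeff {ι : Type*} [Fintype ι] [DecidableEq ι] (f : BoolFun ι)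
    (α : ι → ZMod 2) : ℝ :=
  (∑ x : ι → ZMod 2, bitSign (f x) * bitSign (∑ i, x i * α i)) / 2 ^ Fintype.card ι

/-- Fourier sparsity: the number of nonzero Fourier coefficients. -/
noncomputable def fourierSparsity {ι : Type*} [Fintype ι] [DecidableEq ι] (f : BoolFun ι) : ℕ :=
  {α : ι → ZMod 2 | boolFourierCoeff f α ≠ 0}.ncard

/-! ### Parity decision trees -/

/-- A parity decision tree: leaves carry output bits, internal nodes carry a set of variables. -/
inductive ParityTree (ι : Type*) : Type _
  | leaf (b : ZMod 2) : ParityTree ι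
  | node (α : Finset ι) (left right : ParityTree ι) : ParityTree ι

/-- Evaluation: at a node labelled `α` go right if the parity of the variables in `α` is `1`,
and go left if it is `0`. -/
def ParityTree.eval {ι : Type*} : ParityTree ι → (ι → ZMod 2) → ZMod 2
  | .leaf b, _ => b
  | .node α l r, x => if ∑ i ∈ α, x i = 1 then r.eval x else l.eval x

/-- Depth: the maximal number of internal nodes on a path from the root to a leaf. -/
def ParityTree.depth {ι : Type*} : ParityTree ι → ℕ
  | .leaf _ => 0
  | .node _ l r => max l.depth r.depth + 1

/-- The tree `T` computes `f`. -/
def ParityTree.Computes {ι : Type*} (T : ParityTree ι) (f : BoolFun ι) : Prop :=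
  ∀ x, T.eval x = f x

/-- Parity decision tree complexity: the least depth of a parity decision tree computing `f`. -/
noncomputable def parityDT {ι : Type*} (f : BoolFun ι) : ℕ :=
  sInf {d : ℕ | ∃ T : ParityTree ι, T.Computes f ∧ T.depth = d}

/-- Every Boolean function of finitely many variables is computed by some parity decision tree,
so `parityDT` is a minimum over a nonempty set. -/
theorem ParityTree.exists_computes {ι : Type*} [Fintype ι] [DecidableEq ι] (f : BoolFun ι) :
    ∃ T : ParityTree ι, T.Computes f := by
  suffices h : ∀ (s : Finset ι) (f : BoolFun ι),
      (∀ x y : ι → ZMod 2, (∀ i ∈ s, x i = y i) → f x = f y) →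
        ∃ T : ParityTree ι, T.Computes f from
    h Finset.univ f fun x y hxy => congrArg f (funext fun i => hxy i (Finset.mem_univ i))
  intro s
  induction s using Finset.induction_on with
  | empty => exact fun f hf => ⟨.leaf (f 0), fun x => hf 0 x (by simp)⟩
  | insert a s ha ih =>
    intro f hf
    have key : ∀ c : ZMod 2, ∃ T : ParityTree ι,
        T.Computes (fun x => f (Function.update x a c)) := by
      intro c
      refine ih _ fun x y hxy => hf _ _ fun i hi => ?_
      by_cases hia : i = a
      · subst hia
        simp
      · simp [hia, hxy i ((Finset.mem_insert.1 hi).resolve_left hia)]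
    obtain ⟨l, hl⟩ := key 0
    obtain ⟨r, hr⟩ := key 1
    refine ⟨.node {a} l r, fun x => ?_⟩
    have hb : ∀ b : ZMod 2, b ≠ 1 → b = 0 := by decide
    by_cases h : x a = 1
    · simp only [eval, Finset.sum_singleton, h, if_true, hr x]
      rw [← h, Function.update_eq_self]
    · simp only [eval, Finset.sum_singleton, h, if_false, hl x]
      rw [← hb _ h, Function.update_eq_self]

/-! ### The hemi-icosahedron function -/

/-- The ten facets of the hemi-icosahedron on the vertices `0, …, 5`. -/
def hemiFacets : Finset (Finset (Fin 6)) :=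
  {{0, 1, 2}, {0, 1, 3}, {0, 2, 5}, {0, 3, 4}, {0, 4, 5},
    {1, 2, 4}, {1, 3, 5}, {1, 4, 5}, {2, 3, 4}, {2, 3, 5}}

/-- Kushilevitz's hemi-icosahedron function: `1` on Hamming weights `1, 2, 6`, `0` on Hamming
weights `0, 4, 5`, and on Hamming weight `3` equal to `1` exactly if all three vertices of some
facet are `1`. -/
def hemiIcosahedron : BoolFun (Fin 6) := fun x =>
  if hammingNorm x = 1 ∨ hammingNorm x = 2 ∨ hammingNorm x = 6 then 1
  else if hammingNorm x = 0 ∨ hammingNorm x = 4 ∨ hammingNorm x = 5 then 0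
  else if ∃ F ∈ hemiFacets, ∀ i ∈ F, x i = 1 then 1
  else 0

/-!
The hemi-icosahedron function `HI` satisfies two properties that separate the two quantities.

* On `0/1` inputs it agrees with the real cubic polynomial
  `∑ᵢ zᵢ - ∑ᵢⱼ zᵢ zⱼ + ∑_F ∏_{i ∈ F} zᵢ` (`hemiIcosahedron_val`). The number of characters needed
  to write a function is subadditive and submultiplicative, so if `s` characters suffice for the
  `k`-th power then at most `2 ^ 6 * s ^ 3` suffice for the next one. Hence the logarithm of the
  sparsity of the `k`-th power is at most `4 * 3 ^ k` (`fourierSparsity_power_le`).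
* It is stifled: any one variable may be left free while the others force the value `0`. Write the
  `(k+1)`-st power as `HI^k ∘ HI`. A parity query can be answered by sacrificing one block
  of six variables: one variable of the block absorbs the answer and the other five are fixed so
  that the value of the block is `0` anyway (`ParityTree.exists_eval_eq`). After fewer than `6 ^ k`
  queries some block is untouched; since `HI^k` is `0` at the origin and `1` at all inputs of weight
  one, the value is still undetermined. Hence the depth is at least `6 ^ k`
  (`pow_le_parityDT_power`).

As `(3 ^ k) ^ (log_3 6) = 6 ^ k`, the two bounds combine.
-/

/-! ### Functions spanned by few characters -/

/-- The character `x ↦ (-1)^⟨x, α⟩` of `F₂^ι`. -/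
def character {ι : Type*} [Fintype ι] (α x : ι → ZMod 2) : ℝ := bitSign (∑ i, x i * α i)

/-- `F` is a real linear combination of at most `s` characters. -/
def IsFourierSparse {ι : Type*} [Fintype ι] (s : ℕ) (F : (ι → ZMod 2) → ℝ) : Prop :=
  ∃ A : Finset (ι → ZMod 2), A.card ≤ s ∧ F ∈ Submodule.span ℝ (character '' (A : Set (ι → ZMod 2)))

theorem bitSign_add (a b : ZMod 2) : bitSign (a + b) = bitSign a * bitSign b := by
  have h : ∀ c : ZMod 2, c = 0 ∨ c = 1 := by decide
  have h11 : (1 : ZMod 2) + 1 = 0 := by decide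
  rcases h a with rfl | rfl <;> rcases h b with rfl | rfl <;> simp [bitSign, h11]

theorem bitSign_eq_one_sub (b : ZMod 2) : bitSign b = 1 - 2 * (b.val : ℝ) := by
  have h : ∀ c : ZMod 2, c = 0 ∨ c = 1 := by decide
  rcases h b with rfl | rfl
  · simp [bitSign]
  · simp [bitSign, ZMod.val_one]; norm_num

section Sparse

variable {ι κ : Type*} [Fintype ι] [Fintype κ]

theorem character_add (α β : ι → ZMod 2) : character (α + β) = character α * character β := by
  funext x
  simp only [character, Pi.mul_apply, Pi.add_apply, mul_add, Finset.sum_add_distrib, bitSign_add]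

theorem character_zero : character (0 : ι → ZMod 2) = 1 := by
  funext x
  simp [character, bitSign]

theorem character_comp_apply [DecidableEq κ] (φ : ι → κ) (α : ι → ZMod 2) (x : κ → ZMod 2) :
    character α (fun i => x (φ i)) = character (fun j => ∑ i with φ i = j, α i) x := by
  simp only [character, Finset.mul_sum, Finset.sum_filter, mul_ite, mul_zero]
  rw [Finset.sum_comm]
  simp

/-- Flipping a coordinate on which `α` and `β` differ changes the sign of the summand. -/
theorem sum_character_mul_character [DecidableEq ι] {α β : ι → ZMod 2} (h : α ≠ β) :
    ∑ x, character α x * character β x = 0 := by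
  obtain ⟨i, hi⟩ := Function.ne_iff.1 h
  have hs : (α + β) i = 1 := by
    have key : ∀ a b : ZMod 2, a ≠ b → a + b = 1 := by decide
    exact key _ _ hi
  have hflip : ∀ x, character (α + β) (x + Pi.single i 1) = -character (α + β) x := by
    intro x
    have : ∑ j, (x + Pi.single i 1 : ι → ZMod 2) j * (α + β) j = (∑ j, x j * (α + β) j) + 1 := by
      simp only [Pi.add_apply x, add_mul, Finset.sum_add_distrib, Pi.single_apply, ite_mul,
        one_mul, zero_mul, Finset.sum_ite_eq', Finset.mem_univ, if_true, hs]
    rw [character, this, bitSign_add, character]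
    simp [bitSign]
  have hsum : ∑ x, character (α + β) x = -∑ x, character (α + β) x := by
    rw [← Finset.sum_neg_distrib, ← Equiv.sum_comp (Equiv.addRight (Pi.single i (1 : ZMod 2)))]
    exact Finset.sum_congr rfl fun x _ => hflip x
  have := congrArg (fun F : (ι → ZMod 2) → ℝ => ∑ x, F x) (character_add α β)
  simp only [Pi.mul_apply] at this
  linarith

/-- A character that is not among those spanning the sign function has Fourier coefficient `0`, by
orthogonality. -/
theorem fourierSparsity_le [DecidableEq ι] {f : BoolFun ι} {s : ℕ}
    (hf : IsFourierSparse s fun x => bitSign (f x)) : fourierSparsity f ≤ s := by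
  obtain ⟨A, hA, hmem⟩ := hf
  refine le_trans ?_ hA
  rw [fourierSparsity, ← Set.ncard_coe_finset A]
  refine Set.ncard_le_ncard (fun β hβ => ?_) A.finite_toSet
  by_contra hβA
  refine hβ ?_
  have key : ∀ F ∈ Submodule.span ℝ (character '' (A : Set (ι → ZMod 2))),
      ∑ x, F x * character β x = 0 := by
    intro F hF
    induction hF using Submodule.span_induction with
    | mem F hF =>
      obtain ⟨α, hα, rfl⟩ := hF
      exact sum_character_mul_character fun h => hβA (h ▸ hα)
    | zero => simp
    | add F G _ _ hF hG => simp [add_mul, Finset.sum_add_distrib, hF, hG]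
    | smul c F _ hF => simp [mul_assoc, ← Finset.mul_sum, hF]
  have := key _ hmem
  simp only [character] at this
  simp [boolFourierCoeff, this]

theorem IsFourierSparse.mono {s t : ℕ} {F : (ι → ZMod 2) → ℝ} (h : IsFourierSparse s F)
    (hst : s ≤ t) : IsFourierSparse t F :=
  let ⟨A, hA, hF⟩ := h
  ⟨A, hA.trans hst, hF⟩

theorem isFourierSparse_zero : IsFourierSparse 0 (0 : (ι → ZMod 2) → ℝ) :=
  ⟨∅, by simp, by simp⟩

theorem isFourierSparse_character (α : ι → ZMod 2) : IsFourierSparse 1 (character α) :=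
  ⟨{α}, by simp, Submodule.subset_span ⟨α, by simp⟩⟩

theorem isFourierSparse_one : IsFourierSparse 1 (1 : (ι → ZMod 2) → ℝ) :=
  character_zero (ι := ι) ▸ isFourierSparse_character 0

theorem IsFourierSparse.smul {s : ℕ} {F : (ι → ZMod 2) → ℝ} (c : ℝ) (h : IsFourierSparse s F) :
    IsFourierSparse s (c • F) :=
  let ⟨A, hA, hF⟩ := h
  ⟨A, hA, Submodule.smul_mem _ c hF⟩

theorem IsFourierSparse.add {s t : ℕ} {F G : (ι → ZMod 2) → ℝ} (hF : IsFourierSparse s F)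
    (hG : IsFourierSparse t G) : IsFourierSparse (s + t) (F + G) := by
  classical
  obtain ⟨A, hA, hF⟩ := hF
  obtain ⟨B, hB, hG⟩ := hG
  refine ⟨A ∪ B, (Finset.card_union_le A B).trans (add_le_add hA hB), Submodule.add_mem _ ?_ ?_⟩
  · exact Submodule.span_mono (Set.image_mono (by simp)) hF
  · exact Submodule.span_mono (Set.image_mono (by simp)) hG

theorem IsFourierSparse.mul {s t : ℕ} {F G : (ι → ZMod 2) → ℝ} (hF : IsFourierSparse s F)
    (hG : IsFourierSparse t G) : IsFourierSparse (s * t) (F * G) := by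
  classical
  obtain ⟨A, hA, hF⟩ := hF
  obtain ⟨B, hB, hG⟩ := hG
  refine ⟨Finset.image₂ (· + ·) A B,
    (Finset.card_image₂_le _ A B).trans (Nat.mul_le_mul hA hB), ?_⟩
  have h := Submodule.mul_mem_mul hF hG
  rw [Submodule.span_mul_span] at h
  refine Submodule.span_mono ?_ h
  rintro _ ⟨_, ⟨α, hα, rfl⟩, _, ⟨β, hβ, rfl⟩, rfl⟩
  exact ⟨α + β, Finset.mem_coe.2 (Finset.mem_image₂_of_mem hα hβ), character_add α β⟩

theorem IsFourierSparse.sum {σ : Type*} {s : ℕ} {F : σ → (ι → ZMod 2) → ℝ} (S : Finset σ)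
    (h : ∀ i ∈ S, IsFourierSparse s (F i)) : IsFourierSparse (S.card * s) (∑ i ∈ S, F i) := by
  classical
  induction S using Finset.induction_on with
  | empty => simpa using isFourierSparse_zero
  | insert a S ha ih =>
    rw [Finset.sum_insert ha, Finset.card_insert_of_notMem ha, add_mul, one_mul, add_comm _ s]
    exact (h a (by simp)).add (ih fun i hi => h i (by simp [hi]))

theorem IsFourierSparse.prod {σ : Type*} {s : ℕ} {F : σ → (ι → ZMod 2) → ℝ} (S : Finset σ)
    (h : ∀ i ∈ S, IsFourierSparse s (F i)) : IsFourierSparse (s ^ S.card) (∏ i ∈ S, F i) := by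
  classical
  induction S using Finset.induction_on with
  | empty => simpa using isFourierSparse_one
  | insert a S ha ih =>
    rw [Finset.prod_insert ha, Finset.card_insert_of_notMem ha, pow_succ']
    exact (h a (by simp)).mul (ih fun i hi => h i (by simp [hi]))

theorem IsFourierSparse.comp_apply {s : ℕ} {F : (ι → ZMod 2) → ℝ} (h : IsFourierSparse s F)
    (φ : ι → κ) : IsFourierSparse s fun x : κ → ZMod 2 => F fun i => x (φ i) := by
  classical
  obtain ⟨A, hA, hF⟩ := h
  refine ⟨A.image fun α j => ∑ i with φ i = j, α i, Finset.card_image_le.trans hA, ?_⟩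
  have h := Submodule.mem_map_of_mem
    (f := LinearMap.funLeft ℝ ℝ fun (x : κ → ZMod 2) (i : ι) => x (φ i)) hF
  rw [Submodule.map_span] at h
  refine Submodule.span_mono ?_ h
  rintro _ ⟨_, ⟨α, hα, rfl⟩, rfl⟩
  exact ⟨_, Finset.mem_coe.2 (Finset.mem_image_of_mem _ hα),
    funext fun x => (character_comp_apply φ α x).symm⟩

end Sparse

/-! ### Sparsity of the powers -/

/-- The coefficients of the real polynomial `∑ᵢ zᵢ - ∑ᵢⱼ zᵢ zⱼ + ∑_F ∏_{i ∈ F} zᵢ` that represents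
the hemi-icosahedron function on `0/1` inputs; `F` runs over the facets. -/
def hemiCoeff (S : Finset (Fin 6)) : ℤ :=
  if S.card = 1 then 1 else if S.card = 2 then -1 else if S ∈ hemiFacets then 1 else 0

/-- The hemi-icosahedron function has degree at most `3` over `ℝ`. -/
theorem hemiIcosahedron_val (z : Fin 6 → ZMod 2) :
    ((hemiIcosahedron z).val : ℤ) =
      ∑ S : Finset (Fin 6) with S.card ≤ 3, hemiCoeff S * ∏ i ∈ S, ((z i).val : ℤ) := by
  revert z
  decide +kernel

theorem power_succ_apply {n : ℕ} (f : BoolFun (Fin n)) (k : ℕ) (x : Fin (n ^ (k + 1)) → ZMod 2) :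
    f.power (k + 1) x = f fun i => f.power k fun j =>
      x (Fin.cast (pow_succ' n k).symm (finProdFinEquiv (i, j))) := rfl

theorem isFourierSparse_power (k : ℕ) :
    IsFourierSparse (2 ^ (4 * 3 ^ k - 3))
      fun x => ((hemiIcosahedron.power k x).val : ℝ) := by
  induction k with
  | zero =>
    -- A single variable `b` is `(1 - (-1) ^ b) / 2`.
    have h := ((isFourierSparse_one (ι := Fin (6 ^ 0))).add
      ((isFourierSparse_character (1 : Fin (6 ^ 0) → ZMod 2)).smul (-1))).smul (1 / 2)
    convert h using 1
    · norm_num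
    funext x
    have hx : ∑ i, x i = x ⟨0, by simp⟩ := Fintype.sum_unique (ι := Fin 1) x
    simp only [Pi.smul_apply, Pi.add_apply, Pi.one_apply, character, mul_one, hx, bitSign_eq_one_sub,
      smul_eq_mul, BoolFun.power]
    ring
  | succ k ih =>
    have hcard : (Finset.univ.filter fun S : Finset (Fin 6) => S.card ≤ 3).card ≤ 2 ^ 6 := by
      decide +kernel
    have hpos : 1 ≤ 3 ^ k := Nat.one_le_pow _ _ (by norm_num)
    have h := IsFourierSparse.sum (Finset.univ.filter fun S : Finset (Fin 6) => S.card ≤ 3)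
      (s := (2 ^ (4 * 3 ^ k - 3)) ^ 3)
      (F := fun S => (hemiCoeff S : ℝ) • ∏ i ∈ S, fun x : Fin (6 ^ (k + 1)) → ZMod 2 =>
        ((hemiIcosahedron.power k fun j =>
          x (Fin.cast (pow_succ' 6 k).symm (finProdFinEquiv (i, j)))).val : ℝ))
      fun S hS => ((IsFourierSparse.prod S fun i _ => ih.comp_apply _).mono
        (Nat.pow_le_pow_right (by positivity) (Finset.mem_filter.1 hS).2)).smul _
    have hle : 2 ^ 6 * (2 ^ (4 * 3 ^ k - 3)) ^ 3 ≤ 2 ^ (4 * 3 ^ (k + 1) - 3) := by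
      rw [← pow_mul, ← pow_add]
      exact Nat.pow_le_pow_right (by norm_num) (by rw [pow_succ]; omega)
    convert h.mono ((Nat.mul_le_mul_right _ hcard).trans hle) using 1
    funext x
    rw [power_succ_apply, Finset.sum_apply]
    simp only [Pi.smul_apply, Finset.prod_apply, smul_eq_mul]
    exact_mod_cast hemiIcosahedron_val _

theorem fourierSparsity_power_le (k : ℕ) :
    fourierSparsity (hemiIcosahedron.power k) ≤ 2 ^ (4 * 3 ^ k) := by
  have hpos : 1 ≤ 3 ^ k := Nat.one_le_pow _ _ (by norm_num)
  have hle : 1 + 2 ^ (4 * 3 ^ k - 3) ≤ 2 ^ (4 * 3 ^ k) := by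
    obtain ⟨m, hm⟩ : ∃ m, 4 * 3 ^ k = m + 3 := ⟨4 * 3 ^ k - 3, by omega⟩
    rw [hm, Nat.add_sub_cancel, pow_add]
    have := Nat.one_le_two_pow (n := m)
    omega
  refine fourierSparsity_le (((isFourierSparse_one.add
    ((isFourierSparse_power k).smul (-2))).mono hle).imp fun A hA => ⟨hA.1, ?_⟩)
  convert hA.2 using 1
  funext x
  simp only [bitSign_eq_one_sub, Pi.add_apply, Pi.one_apply, Pi.smul_apply, smul_eq_mul]
  ring

/-! ### Parity decision trees of compositions with a stifled inner function -/

section Stifling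

variable {ι I J : Type*} [DecidableEq I] [DecidableEq J]

/-- `g` is stifled to `0`: each variable can be left free while the other variables are fixed so as
to make `g` equal to `0`. -/
def BoolFun.IsStifled (g : BoolFun J) : Prop :=
  ∀ j, ∃ c : J → ZMod 2, ∀ b, g (Function.update c j b) = 0

/-- The block values of `x`, where `e (i, j)` is the `j`-th variable of the `i`-th block. -/
def blockValues (e : I × J → ι) (g : BoolFun J) (x : ι → ZMod 2) : I → ZMod 2 :=
  fun i => g fun j => x (e (i, j))

/-- A function `φ` that satisfies the affine identity and depends on the coordinate `p`
changes at each point when that coordinate is flipped. -/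
theorem add_single_of_affine {κ : Type*} [DecidableEq κ] {φ : (κ → ZMod 2) → ZMod 2}
    (hφ : ∀ u v w, φ (u + v + w) = φ u + φ v + φ w) {p : κ} {u₀ : κ → ZMod 2}
    (hp : φ (u₀ + Pi.single p 1) ≠ φ u₀) (u : κ → ZMod 2) :
    φ (u + Pi.single p 1) = φ u + 1 := by
  have key : ∀ a b c : ZMod 2, a ≠ b → c + b + a = c + 1 := by decide
  have hu : u + u₀ + (u₀ + Pi.single p 1) = u + Pi.single p 1 := by
    funext q
    have hq : ∀ a b c : ZMod 2, a + b + (b + c) = a + c := by decide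
    exact hq _ _ _
  rw [← hu, hφ, key _ _ _ hp]

theorem eq_const_of_add_single {κ : Type*} [DecidableEq κ] [Fintype κ]
    {φ : (κ → ZMod 2) → ZMod 2} (h : ∀ p u, φ (u + Pi.single p 1) = φ u) (u : κ → ZMod 2) :
    φ u = φ 0 := by
  have key : ∀ s : Finset κ, φ (∑ p ∈ s, Pi.single p (u p)) = φ 0 := by
    intro s
    induction s using Finset.induction_on with
    | empty => simp
    | insert a s ha ih =>
      have hb : ∀ b : ZMod 2, b = 0 ∨ b = 1 := by decide
      rw [Finset.sum_insert ha, add_comm]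
      rcases hb (u a) with h0 | h1
      · simpa [h0] using ih
      · rw [h1, h, ih]
  simpa [Finset.univ_sum_single] using key Finset.univ

/-- The adversary argument. The inputs still consistent with the answers given so far are those of
the form `Y u`, with `Y` affine; the blocks in `S` are still free, and the others are
forced to have value `0`. A query that is not constant on these inputs depends on some parameter
`p`; the adversary stifles the block of `p` and spends `p` to make the answer `0`. -/
theorem ParityTree.exists_eval_eq [Fintype I] [Fintype J] (e : I × J → ι) {g : BoolFun J}
    (hg : g.IsStifled) {a b : J → ZMod 2} (ha : g a = 0) (hb : g b = 1) (T : ParityTree ι) :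
    ∀ (S : Finset I) (Y : (I × J → ZMod 2) → ι → ZMod 2), T.depth < S.card →
      (∀ u v w, Y (u + v + w) = Y u + Y v + Y w) →
      (∀ u, ∀ i ∈ S, ∀ j, Y u (e (i, j)) = u (i, j)) →
      (∀ u, ∀ i ∉ S, blockValues e g (Y u) i = 0) →
      ∃ u v i, T.eval (Y u) = T.eval (Y v) ∧ blockValues e g (Y u) = 0 ∧
        blockValues e g (Y v) = Pi.single i 1 := by
  induction T with
  | leaf t =>
    intro S Y hS _ hfree hdead
    obtain ⟨i₀, hi₀⟩ := Finset.card_pos.1 hS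
    refine ⟨fun p => a p.2, fun p => if p.1 = i₀ then b p.2 else a p.2, i₀, rfl, ?_, ?_⟩
    · funext i
      by_cases hi : i ∈ S
      · simpa [blockValues, hfree _ i hi] using ha
      · exact hdead _ i hi
    · funext i
      by_cases hi : i ∈ S
      · by_cases h : i = i₀
        · subst h
          simpa [blockValues, hfree _ i hi] using hb
        · simpa [blockValues, hfree _ i hi, h] using ha
      · rw [hdead _ i hi, Pi.single_eq_of_ne (ne_of_mem_of_not_mem hi₀ hi).symm]
  | node α l r ihl ihr =>
    intro S Y hS hY hfree hdead
    simp only [ParityTree.depth] at hS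
    set φ : (I × J → ZMod 2) → ZMod 2 := fun u => ∑ i ∈ α, Y u i with hφdef
    have hφ : ∀ u v w, φ (u + v + w) = φ u + φ v + φ w := by
      intro u v w
      simp [hφdef, hY, Finset.sum_add_distrib]
    by_cases hdep : ∃ p u, φ (u + Pi.single p 1) ≠ φ u
    · obtain ⟨⟨i₀, j₀⟩, u₀, hu₀⟩ := hdep
      have hflip := add_single_of_affine hφ hu₀
      obtain ⟨c, hc⟩ := hg j₀
      have hbit : ∀ b : ZMod 2, b = 0 ∨ b = 1 := by decide
      have h3 : ∀ b : ZMod 2, b = b + b + b := by decide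
      set w : (I × J → ZMod 2) → I × J → ZMod 2 := fun u p =>
        if p.1 = i₀ then if p.2 = j₀ then 0 else c p.2 else u p with hw
      have hw_add : ∀ u v z, w (u + v + z) = w u + w v + w z := by
        intro u v z
        funext p
        simp only [hw, Pi.add_apply]
        split_ifs
        · simp
        · exact h3 _
        · rfl
      set h : (I × J → ZMod 2) → I × J → ZMod 2 := fun u =>
        w u + Pi.single (i₀, j₀) (φ (w u)) with hh
      have hzero : ∀ u, φ (h u) = 0 := by
        intro u
        rcases hbit (φ (w u)) with h0 | h1
        · simp [hh, h0]
        · simp only [hh]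
          rw [h1, hflip, h1]
          decide
      have hne : ∀ u i j, i ≠ i₀ → h u (i, j) = u (i, j) := by
        intro u i j hi
        simp [hh, hw, hi]
      have heq : ∀ u j, h u (i₀, j) = Function.update c j₀ (φ (w u)) j := by
        intro u j
        by_cases hj : j = j₀
        · subst hj
          simp [hh, hw]
        · simp [hh, hw, hj]
      obtain ⟨u, v, i, huv, hu, hv⟩ := ihl (S.erase i₀) (fun u => Y (h u))
        (by
          have := Finset.pred_card_le_card_erase (s := S) (a := i₀)
          have := le_max_left l.depth r.depth
          omega)
        (fun u v z => by
          rw [← hY]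
          simp only [hh]
          rw [hw_add, hφ, Pi.single_add, Pi.single_add]
          congr 1
          abel)
        (fun u i hi j => by
          rw [hfree _ i (Finset.mem_of_mem_erase hi), hne _ _ _ (Finset.ne_of_mem_erase hi)])
        (fun u i hi => by
          by_cases hiS : i ∈ S
          · obtain rfl : i = i₀ := by
              by_contra hne'
              exact hi (Finset.mem_erase.2 ⟨hne', hiS⟩)
            simp only [blockValues, hfree _ i hiS, heq]
            exact hc _
          · exact hdead _ i hiS)
      refine ⟨h u, h v, i, ?_, hu, hv⟩
      have hz : ∀ u, ∑ i ∈ α, Y (h u) i = 0 := hzero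
      simpa [ParityTree.eval, hz] using huv
    · push Not at hdep
      have hconst : ∀ u, ∑ i ∈ α, Y u i = φ 0 := eq_const_of_add_single hdep
      by_cases h1 : φ 0 = 1
      · obtain ⟨u, v, i, huv, hu, hv⟩ := ihr S Y
          (by have := le_max_right l.depth r.depth; omega) hY hfree hdead
        exact ⟨u, v, i, by simpa [ParityTree.eval, hconst, h1] using huv, hu, hv⟩
      · obtain ⟨u, v, i, huv, hu, hv⟩ := ihl S Y
          (by have := le_max_left l.depth r.depth; omega) hY hfree hdead
        exact ⟨u, v, i, by simpa [ParityTree.eval, hconst, h1] using huv, hu, hv⟩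

/-- If the value of `f` at `0` changes under every flip of one variable and `g` is stifled, the
composition of `f` with `g` has parity decision tree complexity at least the number of variables
of `f`. -/
theorem card_le_parityDT [Fintype ι] [DecidableEq ι] [Fintype I] [Fintype J] (e : I × J ≃ ι)
    {f : BoolFun I} {g : BoolFun J} (hf : ∀ i, f (Pi.single i 1) ≠ f 0) (hg : g.IsStifled)
    {a b : J → ZMod 2} (ha : g a = 0) (hb : g b = 1) {F : BoolFun ι}
    (hF : ∀ x, F x = f (blockValues e g x)) : Fintype.card I ≤ parityDT F := by
  obtain ⟨T₀, hT₀⟩ := ParityTree.exists_computes F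
  refine le_csInf ⟨_, T₀, hT₀, rfl⟩ ?_
  rintro _ ⟨T, hT, rfl⟩
  by_contra! hlt
  obtain ⟨u, v, i, huv, hu, hv⟩ := T.exists_eval_eq e hg ha hb Finset.univ
    (fun u p => u (e.symm p)) (by simpa using hlt) (fun _ _ _ => rfl) (fun u i _ j => by simp)
    (fun _ i hi => absurd (Finset.mem_univ i) hi)
  rw [hT, hT, hF, hF, hu, hv] at huv
  exact hf i huv.symm

end Stifling

/-! ### Parity decision tree complexity of the powers -/

/-- The `(k+1)`-st power is also the composition of the `k`-th power with `f`. -/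
theorem power_succ_apply_inner {n : ℕ} (f : BoolFun (Fin n)) (k : ℕ)
    (x : Fin (n ^ (k + 1)) → ZMod 2) :
    f.power (k + 1) x =
      f.power k (blockValues (finProdFinEquiv.trans (finCongr (pow_succ n k).symm)) f x) := by
  induction k with
  | zero =>
    rw [power_succ_apply]
    simp only [BoolFun.power, blockValues]
    congr 1
    funext i
    congr 1
    ext
    change 0 + n ^ 0 * (i : ℕ) = (i : ℕ) + n * 0
    simp
  | succ k ih =>
    rw [power_succ_apply, power_succ_apply]
    congr 1
    funext i
    rw [ih]
    congr 1
    funext j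
    simp only [blockValues]
    congr 1
    funext l
    congr 1
    ext
    simp
    ring

theorem power_zero_eq_zero {n : ℕ} {f : BoolFun (Fin n)} (hf : f 0 = 0) (k : ℕ) :
    f.power k 0 = 0 := by
  induction k with
  | zero => rfl
  | succ k ih =>
    rw [power_succ_apply, ← hf]
    exact congrArg f (funext fun i => ih)

/-- If `f` vanishes at `0` and is `1` at the inputs of weight `1`, so are its powers. -/
theorem power_single_eq_one {n : ℕ} {f : BoolFun (Fin n)} (hf : f 0 = 0)
    (hf' : ∀ i, f (Pi.single i 1) = 1) (k : ℕ) (p : Fin (n ^ k)) :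
    f.power k (Pi.single p 1) = 1 := by
  induction k with
  | zero =>
    obtain rfl : p = ⟨0, by simp⟩ := Subsingleton.elim (α := Fin 1) _ _
    exact Pi.single_eq_same _ _
  | succ k ih =>
    obtain ⟨⟨i, j⟩, rfl⟩ := (finProdFinEquiv.trans (finCongr (pow_succ' n k).symm)).surjective p
    rw [power_succ_apply]
    refine Eq.trans ?_ (hf' i)
    congr 1
    funext i'
    by_cases hi : i' = i
    · subst hi
      rw [Pi.single_eq_same]
      refine Eq.trans ?_ (ih j)
      congr 1
      funext j'
      simp [Pi.single_apply]
    · rw [Pi.single_eq_of_ne hi, ← power_zero_eq_zero hf k]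
      congr 1
      funext j'
      simp [hi]

theorem hemiIcosahedron_isStifled : hemiIcosahedron.IsStifled := by
  intro j
  -- With four or five ones the value is `0`; fix four ones and one zero outside `j`.
  refine ⟨fun i => if i = j + 1 then 0 else 1, ?_⟩
  revert j
  decide +kernel

theorem pow_le_parityDT_power (k : ℕ) : 6 ^ k ≤ parityDT (hemiIcosahedron.power (k + 1)) := by
  have h0 : hemiIcosahedron 0 = 0 := by decide +kernel
  have h1 : ∀ i, hemiIcosahedron (Pi.single i 1) = 1 := by decide +kernel
  have h := card_le_parityDT (f := hemiIcosahedron.power k)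
    (finProdFinEquiv.trans (finCongr (pow_succ 6 k).symm))
    (fun i => by rw [power_single_eq_one h0 h1, power_zero_eq_zero h0]; decide)
    hemiIcosahedron_isStifled h0 (h1 0) (power_succ_apply_inner hemiIcosahedron k)
  simpa using h

theorem corollary10 :
    ∃ c : ℝ, 0 < c ∧ ∀ k : ℕ, 1 ≤ k →
      c * Real.logb 2 (fourierSparsity (hemiIcosahedron.power k) : ℝ) ^ Real.logb 3 6 ≤
        (parityDT (hemiIcosahedron.power k) : ℝ) := by
  refine ⟨1 / (6 * 4 ^ Real.logb 3 6), by positivity, fun k hk => ?_⟩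
  obtain ⟨k, rfl⟩ := Nat.exists_eq_add_of_le' hk
  set s := fourierSparsity (hemiIcosahedron.power (k + 1)) with hs
  have hle : s ≤ 2 ^ (4 * 3 ^ (k + 1)) := fourierSparsity_power_le (k + 1)
  have hlog : Real.logb 2 (s : ℝ) ≤ 4 * 3 ^ (k + 1) := by
    rcases Nat.eq_zero_or_pos s with h | h
    · rw [h, Nat.cast_zero, Real.logb_zero]
      positivity
    · calc Real.logb 2 (s : ℝ) ≤ Real.logb 2 ((2 : ℝ) ^ (4 * 3 ^ (k + 1))) :=
            Real.logb_le_logb_of_le (by norm_num) (by exact_mod_cast h) (by exact_mod_cast hle)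
        _ = 4 * 3 ^ (k + 1) := by
            rw [Real.logb_pow, Real.logb_self_eq_one (by norm_num)]
            push_cast
            ring
  have hlog0 : 0 ≤ Real.logb 2 (s : ℝ) :=
    div_nonneg (Real.log_natCast_nonneg s) (Real.log_nonneg (by norm_num))
  have hexp : 0 ≤ Real.logb 3 6 := Real.logb_nonneg (by norm_num) (by norm_num)
  have h36 : ((3 : ℝ) ^ (k + 1)) ^ Real.logb 3 6 = 6 ^ (k + 1) := by
    rw [← Real.rpow_natCast_mul (by norm_num), mul_comm, Real.rpow_mul_natCast (by norm_num),
      Real.rpow_logb (by norm_num) (by norm_num) (by norm_num)]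
  calc 1 / (6 * 4 ^ Real.logb 3 6) * Real.logb 2 (s : ℝ) ^ Real.logb 3 6
      ≤ 1 / (6 * 4 ^ Real.logb 3 6) * (4 * 3 ^ (k + 1)) ^ Real.logb 3 6 := by
        gcongr
    _ = 6 ^ k := by
        rw [Real.mul_rpow (by norm_num) (by positivity), h36, pow_succ]
        have : (0 : ℝ) < 4 ^ Real.logb 3 6 := by positivity
        field_simp
    _ ≤ _ := by exact_mod_cast pow_le_parityDT_power k
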